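/- For a rational number $x$ let $(x)_0=1$ and $(x)_j=x(x+1)\cdots(x+j-1)$ for $j\ge 1$, and write $$\left[\begin{matrix}a_1,a_2,a_3\\ b_1,b_2,b_3\end{matrix}\right]_j=\frac{(a_1)_j(a_2)_j(a_3)_j}{(b_1)_j(b_2)_j(b_3)_j}.$$ A formula $S=\sum_{j=0}^{\infty}z^j\left[\begin{matrix}a_1,a_2,a_3\\ b_1,b_2,b_3\end{matrix}\right]_j(c_1j+c_2)$, in which $a_i,b_i,c_i,z$ are rational and no $b_k$ is a non-positive integer, is of Ramanujan type if no difference $a_i-b_k$ is an integer and $S$ is given in closed form; its convergence rate is the limit of the ratio of consecutive terms of the series. The following formulas hold, with convergent series, and all of them are of Ramanujan type with convergence rate $\frac14$: \begin{align*} \frac{105\pi}{32\sqrt3}&=\sum_{j=0}^{\infty}\left(\frac14\right)^j\left[\begin{matrix}\frac53,2,\frac73\\ \frac{11}6,\frac{13}6,\frac52\end{matrix}\right]_j(3j+4),\\ \frac{7\sqrt2}{8}&=\sum_{j=0}^{\infty}\left(\frac14\right)^j\left[\begin{matrix}\frac12,\frac54,\frac32\\ 1,\frac{11}8,\frac{15}8\end{matrix}\right]_j(j+1),\\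 \frac{4301\sqrt3}{256}&=\sum_{j=0}^{\infty}\left(\frac14\right)^j\left[\begin{matrix}\frac32,\frac73,\frac83\\ 1,\frac{29}{12},\frac{35}{12}\end{matrix}\right]_j(9j+16),\\ \frac{935\sqrt3}{128}&=\sum_{j=0}^{\infty}\left(\frac14\right)^j\left[\begin{matrix}\frac12,\frac53,\frac73\\ 1,\frac{23}{12},\frac{29}{12}\end{matrix}\right]_j(9j+10),\\ \frac{1729\sqrt3}{128}&=\sum_{j=0}^{\infty}\left(\frac14\right)^j\left[\begin{matrix}\frac32,\frac53,\frac73\\ 1,\frac{25}{12},\frac{31}{12}\end{matrix}\right]_j(9j+14),\\ \frac{27\sqrt[3]2}{4}&=\sum_{j=0}^{\infty}\left(\frac14\right)^j\left[\begin{matrix}\frac23,\frac56,\frac76\\ 1,\frac54,\frac74\end{matrix}\right]_j(9j+7). \end{align*} -/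

import Mathlib

open Filter Topology

noncomputable section

/-- The rising factorial `(x)_n = x (x + 1) ⋯ (x + n - 1)`, with `(x)_0 = 1`, at a rational
argument and as a real number. -/
def risingFactorial (x : ℚ) (n : ℕ) : ℝ := ∏ i ∈ Finset.range n, ((x : ℝ) + (i : ℝ))

/-- The `j`-th term `z ^ j * [a₁, a₂, a₃; b₁, b₂, b₃]_j * (c₁ j + c₂)`, where the bracket is
the quotient of `(a₁)_j (a₂)_j (a₃)_j` by `(b₁)_j (b₂)_j (b₃)_j`. -/
def ramanujanTerm (z : ℚ) (a b : Fin 3 → ℚ) (c₁ c₂ : ℚ) (j : ℕ) : ℝ :=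
  (z : ℝ) ^ j * ((∏ i, risingFactorial (a i) j) / (∏ i, risingFactorial (b i) j)) *
    ((c₁ : ℝ) * (j : ℝ) + (c₂ : ℝ))

/-- The formula `S = ∑ j, z ^ j * [a₁, a₂, a₃; b₁, b₂, b₃]_j * (c₁ j + c₂)` holds, and it is of
Ramanujan type with convergence rate `z`. -/
structure IsRamanujanTypeFormula (z : ℚ) (a b : Fin 3 → ℚ) (c₁ c₂ : ℚ) (S : ℝ) : Prop where
  /-- No lower parameter is a non-positive integer, so that no denominator vanishes. -/
  lower_ne : ∀ k, ∀ m : ℕ, b k ≠ -(m : ℚ)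
  /-- No upper and lower parameter differ by an integer. -/
  irreducible : ∀ i k, ∀ m : ℤ, a i - b k ≠ (m : ℚ)
  /-- The ratio of consecutive terms tends to the convergence rate `z`. -/
  rate : Tendsto (fun j => ramanujanTerm z a b c₁ c₂ (j + 1) / ramanujanTerm z a b c₁ c₂ j)
    atTop (𝓝 (z : ℝ))
  /-- The series converges, with sum `S`. -/
  hasSum : HasSum (ramanujanTerm z a b c₁ c₂) S

end

/-! The sums come from two sources. The series for `π` is a beta integral: its bracket is a constant
times `(1)_k / (3/2)_k` with `k = 3 j + 4`, which is `∫ (1 - u²) ^ k` over `[0, 1]`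
(`realRising_triple`, `integral_one_sub_sq_pow`). Summing under the integral sign leaves a rational
function with an explicit primitive (`integral_rational_eq_pi`).

The other five are members of a two-parameter family, `hasSum_quarterTerm`, proved in WZ style. The
summands at `c + 1` and `c` are proportional up to a telescoping difference, so the sum satisfies a
first-order recurrence in `c`, which the Gamma quotient `quarterValue` satisfies too. Their ratio is
thus unchanged by `c ↦ c + 1`. As `c → ∞`, after division by `2 (s + c)`, the series tends to the
binomial series of `(1 - 1/2) ^ (-s)` and the Gamma quotient tends to `2 ^ s`, so the ratio is `1`.
Reflection and duplication of `Γ` give the closed forms. -/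

/-! ### Rising factorials, the binomial series and Gamma asymptotics. -/

/-- The rising factorial of a real number. -/
noncomputable def realRising (x : ℝ) (n : ℕ) : ℝ := ∏ i ∈ Finset.range n, (x + (i : ℝ))

lemma risingFactorial_eq_realRising (x : ℚ) (n : ℕ) :
    risingFactorial x n = realRising (x : ℝ) n := rfl

@[simp] lemma realRising_zero (x : ℝ) : realRising x 0 = 1 := by simp [realRising]

lemma realRising_succ (x : ℝ) (n : ℕ) : realRising x (n + 1) = realRising x n * (x + n) :=
  Finset.prod_range_succ _ _

lemma realRising_add_one {x : ℝ} (hx : x ≠ 0) (n : ℕ) :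
    realRising (x + 1) n = realRising x n * (x + n) / x := by
  induction n with
  | zero => simp [hx]
  | succ n ih =>
    rw [realRising_succ, ih, realRising_succ]
    push_cast
    field_simp
    ring

lemma realRising_pos {x : ℝ} (hx : 0 < x) (n : ℕ) : 0 < realRising x n :=
  Finset.prod_pos fun _ _ => by positivity

lemma realRising_eq_eval_ascPochhammer (x : ℝ) (n : ℕ) :
    realRising x n = (ascPochhammer ℝ n).eval x := by
  induction n with
  | zero => simp
  | succ n ih => rw [realRising_succ, ih, ascPochhammer_succ_eval]

lemma realRising_one (n : ℕ) : realRising 1 n = n.factorial := by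
  rw [realRising_eq_eval_ascPochhammer]
  exact ascPochhammer_eval_one ℝ n

lemma Gamma_add_natCast {x : ℝ} (hx : 0 < x) (n : ℕ) :
    Real.Gamma (x + n) = Real.Gamma x * realRising x n := by
  induction n with
  | zero => simp
  | succ n ih =>
    rw [realRising_succ, ← mul_assoc, ← ih, Nat.cast_succ, ← add_assoc,
      Real.Gamma_add_one (by positivity)]
    ring

/-- The binomial series of `(1 - 1/2) ^ (-s)`. -/
lemma hasSum_realRising_half (s : ℝ) :
    HasSum (fun j : ℕ => realRising s j / realRising 1 j * (1 / 2 : ℝ) ^ j) ((2 : ℝ) ^ s) := by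
  have h := (Real.one_div_one_sub_rpow_hasFPowerSeriesOnBall_zero s).hasSum
    (y := (1 / 2 : ℝ)) (by
      rw [Metric.mem_eball, edist_dist, Real.dist_eq]
      norm_num [ENNReal.ofReal_lt_one])
  convert! h using 1
  · funext n
    have h1 := Ring.factorial_nsmul_multichoose_eq_ascPochhammer s n
    rw [Polynomial.ascPochhammer_smeval_eq_eval] at h1
    rw [FormalMultilinearSeries.ofScalars_apply_eq, ← Ring.multichoose_eq, realRising_one,
      realRising_eq_eval_ascPochhammer, ← h1]
    have : (n.factorial : ℝ) ≠ 0 := by positivity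
    simp only [nsmul_eq_mul, smul_eq_mul]
    field_simp
  · rw [zero_add, sub_half, one_div, ← Real.inv_rpow (by norm_num), one_div, inv_inv]

lemma tendsto_natCast_add_div_natCast_add (p q : ℝ) :
    Tendsto (fun n : ℕ => ((n : ℝ) + p) / ((n : ℝ) + q)) atTop (𝓝 1) := by
  have h : Tendsto (fun n : ℕ => (p - q) / ((n : ℝ) + q)) atTop (𝓝 0) :=
    (tendsto_atTop_add_const_right _ q tendsto_natCast_atTop_atTop).const_div_atTop _
  have h2 : Tendsto (fun n : ℕ => 1 + (p - q) / ((n : ℝ) + q)) atTop (𝓝 1) := by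
    simpa using h.const_add 1
  refine h2.congr' ?_
  filter_upwards [(tendsto_atTop_add_const_right _ q
    tendsto_natCast_atTop_atTop).eventually_gt_atTop (0 : ℝ)] with n hn
  have : (n : ℝ) + q ≠ 0 := ne_of_gt hn
  field_simp
  ring

/-- Stirling-type normalisation: `Γ(x + n + 1) ∼ n ^ x n!`. -/
lemma tendsto_Gamma_div_rpow_mul_factorial {x : ℝ} (hx : 0 < x) :
    Tendsto (fun n : ℕ => Real.Gamma (x + n + 1) / ((n : ℝ) ^ x * n.factorial)) atTop (𝓝 1) := by
  have hG : Real.Gamma x ≠ 0 := (Real.Gamma_pos_of_pos hx).ne'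
  have h := (tendsto_const_nhds (x := Real.Gamma x)).div (Real.GammaSeq_tendsto_Gamma x) hG
  rw [div_self hG] at h
  refine h.congr fun n => ?_
  have h1 := Gamma_add_natCast hx (n + 1)
  push_cast at h1
  rw [add_assoc, h1, Pi.div_apply, Real.GammaSeq, realRising, div_div_eq_mul_div]

/-! ### The series for `π` as an integral. -/

section integral

/-- Since `u (1 - u²) ^ (k + 1)` vanishes at both endpoints, integrating its derivative gives a
recurrence in `k`. -/
lemma integral_one_sub_sq_pow (k : ℕ) :
    ∫ u in (0 : ℝ)..1, (1 - u ^ 2) ^ k = realRising 1 k / realRising (3 / 2) k := by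
  induction k with
  | zero => simp
  | succ k ih =>
    have hd : ∀ u : ℝ, HasDerivAt (fun u : ℝ => u * (1 - u ^ 2) ^ (k + 1))
        ((2 * k + 3) * (1 - u ^ 2) ^ (k + 1) - (2 * k + 2) * (1 - u ^ 2) ^ k) u := by
      intro u
      have := (hasDerivAt_id u).mul ((((hasDerivAt_id u).pow 2).const_sub 1).pow (k + 1))
      convert! this using 1
      simp
      ring
    have h := intervalIntegral.integral_eq_sub_of_hasDerivAt (a := 0) (b := 1)
      (fun u _ => hd u) (by apply Continuous.intervalIntegrable; fun_prop)
    rw [intervalIntegral.integral_sub (by apply Continuous.intervalIntegrable; fun_prop)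
      (by apply Continuous.intervalIntegrable; fun_prop), intervalIntegral.integral_const_mul,
      intervalIntegral.integral_const_mul, ih] at h
    have h2 := realRising_pos (x := 3 / 2) (by norm_num) k
    rw [realRising_succ, realRising_succ]
    simp at h
    field_simp at h ⊢
    linarith

lemma hasSum_three_mul_add_four {y : ℝ} (hy : |y| < 1) :
    HasSum (fun j : ℕ => (3 * (j : ℝ) + 4) * y ^ j) ((4 - y) / (1 - y) ^ 2) := by
  have h1 := (hasSum_coe_mul_geometric_of_norm_lt_one (r := y) (by simpa using hy)).mul_left 3
  have h2 := (hasSum_geometric_of_norm_lt_one (ξ := y) (by simpa using hy)).mul_left 4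
  have : 1 - y ≠ 0 := by have := (abs_lt.1 hy).2; linarith
  convert! h1.add h2 using 1
  · funext j; ring
  · field_simp; ring

lemma integral_rational_eq_pi :
    ∫ u in (0 : ℝ)..1, (1 - u ^ 2) ^ 4 * (4 * (16 - (1 - u ^ 2) ^ 3)) / (4 - (1 - u ^ 2) ^ 3) ^ 2
      = 4 * Real.pi / (3 * Real.sqrt 3) := by
  set r := Real.sqrt 3 with hr
  have hr2 : r ^ 2 = 3 := Real.sq_sqrt (by norm_num)
  have hr0 : 0 < r := Real.sqrt_pos.2 (by norm_num)
  have hN : ∀ u ∈ Set.uIcc (0 : ℝ) 1, 0 < 4 - (1 - u ^ 2) ^ 3 := by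
    intro u hu
    rw [Set.uIcc_of_le zero_le_one] at hu
    have : (1 - u ^ 2) ^ 3 ≤ 1 := pow_le_one₀ (by nlinarith [hu.1, hu.2]) (by nlinarith)
    linarith
  have hW : ∀ u ∈ Set.uIcc (0 : ℝ) 1, 0 < r * (1 - u ^ 2) - (u ^ 3 - 3 * u) := by
    intro u hu
    rw [Set.uIcc_of_le zero_le_one] at hu
    rcases hu.1.eq_or_lt with h0 | h0
    · subst h0; simpa using hr0
    · have : 0 ≤ r * (1 - u ^ 2) := mul_nonneg hr0.le (by nlinarith [hu.2])
      nlinarith [hu.2, mul_pos h0 h0]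
  -- With `w = r (1 - u²)` and `v = u³ - 3 u`, the natural angle is `arctan (v / w)`, but `w`
  -- vanishes at `u = 1`. Rotating by `π / 4` to `(w + v) / (w - v)` keeps the denominator positive
  -- on `[0, 1]`. The rational part vanishes at both endpoints.
  have hd : ∀ u ∈ Set.uIcc (0 : ℝ) 1, HasDerivAt (fun u : ℝ =>
      (12 * u - 24 * u ^ 3 + 56 / 3 * u ^ 5 - 8 * u ^ 7 + 4 / 3 * u ^ 9) / (4 - (1 - u ^ 2) ^ 3)
      - 8 / (3 * r) * Real.arctan ((r * (1 - u ^ 2) + (u ^ 3 - 3 * u)) /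
        (r * (1 - u ^ 2) - (u ^ 3 - 3 * u))))
      ((1 - u ^ 2) ^ 4 * (4 * (16 - (1 - u ^ 2) ^ 3)) / (4 - (1 - u ^ 2) ^ 3) ^ 2) u := by
    intro u hu
    have hNu := (hN u hu).ne'
    have hWu := (hW u hu).ne'
    have dv : HasDerivAt (fun u : ℝ => u ^ 3 - 3 * u) (3 * u ^ 2 - 3) u := by
      convert! (hasDerivAt_pow 3 u).sub ((hasDerivAt_id u).const_mul 3) using 1
      simp
    have dw : HasDerivAt (fun u : ℝ => r * (1 - u ^ 2)) (r * (-(2 * u))) u := by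
      convert! ((hasDerivAt_pow 2 u).const_sub 1).const_mul r using 1
      simp
    have dN : HasDerivAt (fun u : ℝ => 4 - (1 - u ^ 2) ^ 3) (6 * u * (1 - u ^ 2) ^ 2) u := by
      convert! (((hasDerivAt_pow 2 u).const_sub 1).pow 3).const_sub 4 using 1
      simp
      ring
    have dq : HasDerivAt (fun u : ℝ =>
        12 * u - 24 * u ^ 3 + 56 / 3 * u ^ 5 - 8 * u ^ 7 + 4 / 3 * u ^ 9)
        (12 - 72 * u ^ 2 + 280 / 3 * u ^ 4 - 56 * u ^ 6 + 12 * u ^ 8) u := by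
      convert! (((((hasDerivAt_id u).const_mul 12).sub ((hasDerivAt_pow 3 u).const_mul 24)).add
        ((hasDerivAt_pow 5 u).const_mul (56 / 3))).sub ((hasDerivAt_pow 7 u).const_mul 8)).add
        ((hasDerivAt_pow 9 u).const_mul (4 / 3)) using 1
      simp
      ring
    have da := ((dw.add dv).div (dw.sub dv) hWu).arctan
    have hang : 1 / (1 + ((r * (1 - u ^ 2) + (u ^ 3 - 3 * u)) /
          (r * (1 - u ^ 2) - (u ^ 3 - 3 * u))) ^ 2) *
        (((r * (-(2 * u)) + (3 * u ^ 2 - 3)) * (r * (1 - u ^ 2) - (u ^ 3 - 3 * u)) -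
          (r * (1 - u ^ 2) + (u ^ 3 - 3 * u)) * (r * (-(2 * u)) - (3 * u ^ 2 - 3))) /
          (r * (1 - u ^ 2) - (u ^ 3 - 3 * u)) ^ 2) =
        -(r * (3 + u ^ 4)) / (4 - (1 - u ^ 2) ^ 3) := by
      -- This rests on `3 (1 - u²)² + (u³ - 3 u)² = 4 - (1 - u²)³`, which ties the arctangent to the
      -- denominator of the integrand.
      have hs : (r * (1 - u ^ 2) - (u ^ 3 - 3 * u)) ^ 2 + (r * (1 - u ^ 2) + (u ^ 3 - 3 * u)) ^ 2
          = 2 * (4 - (1 - u ^ 2) ^ 3) := by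
        linear_combination 2 * (1 - u ^ 2) ^ 2 * hr2
      have h1 : 1 + ((r * (1 - u ^ 2) + (u ^ 3 - 3 * u)) /
          (r * (1 - u ^ 2) - (u ^ 3 - 3 * u))) ^ 2 =
          2 * (4 - (1 - u ^ 2) ^ 3) / (r * (1 - u ^ 2) - (u ^ 3 - 3 * u)) ^ 2 := by
        rw [← hs, div_pow, add_div (_ ^ 2), div_self (pow_ne_zero 2 hWu)]
      rw [h1, one_div_div, div_mul_div_comm, mul_comm (2 * _), mul_div_mul_left _ _
        (pow_ne_zero 2 hWu), div_eq_div_iff (mul_ne_zero two_ne_zero hNu) hNu]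
      ring
    have := (dq.div dN hNu).sub (da.const_mul (8 / (3 * r)))
    convert! this using 1
    simp only [Pi.add_apply, Pi.sub_apply, Pi.div_apply] at *
    rw [hang]
    field_simp
    ring
  rw [intervalIntegral.integral_eq_sub_of_hasDerivAt hd]
  · have h1 : (r * (1 - (1 : ℝ) ^ 2) + (1 ^ 3 - 3 * 1)) / (r * (1 - 1 ^ 2) - (1 ^ 3 - 3 * 1)) = -1 := by
      norm_num
    have h0 : (r * (1 - (0 : ℝ) ^ 2) + (0 ^ 3 - 3 * 0)) / (r * (1 - 0 ^ 2) - (0 ^ 3 - 3 * 0)) = 1 := by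
      simp [hr0.ne']
    simp only [h1, h0, Real.arctan_neg, Real.arctan_one]
    field_simp
    ring
  · apply ContinuousOn.intervalIntegrable
    apply ContinuousOn.div (by fun_prop) (by fun_prop)
    exact fun u hu => pow_ne_zero 2 (hN u hu).ne'

lemma hasSum_mul_integral_one_sub_sq_pow :
    HasSum (fun j : ℕ => (3 * (j : ℝ) + 4) * (1 / 4) ^ j *
      ∫ u in (0 : ℝ)..1, (1 - u ^ 2) ^ (3 * j + 4)) (4 * Real.pi / (3 * Real.sqrt 3)) := by
  rw [← integral_rational_eq_pi]
  simp_rw [← intervalIntegral.integral_const_mul]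
  have hx : ∀ u ∈ Set.uIoc (0 : ℝ) 1, 0 ≤ 1 - u ^ 2 ∧ 1 - u ^ 2 ≤ 1 := by
    intro u hu
    rw [Set.uIoc_of_le zero_le_one] at hu
    constructor <;> nlinarith [hu.1, hu.2]
  -- On `(0, 1]` the base `1 - u²` lies in `[0, 1]`, so the coefficients themselves dominate,
  -- uniformly in `u`.
  refine intervalIntegral.hasSum_integral_of_dominated_convergence
    (fun j _ => (3 * (j : ℝ) + 4) * (1 / 4) ^ j)
    (fun n => Continuous.aestronglyMeasurable (by fun_prop)) (fun n => MeasureTheory.ae_of_all _ fun u hu => ?_)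
    (MeasureTheory.ae_of_all _ fun u _ => ?_) intervalIntegrable_const (MeasureTheory.ae_of_all _ fun u hu => ?_)
  · obtain ⟨h0, h1⟩ := hx u hu
    rw [Real.norm_of_nonneg (by positivity)]
    exact mul_le_of_le_one_right (by positivity) (pow_le_one₀ h0 h1)
  · exact (hasSum_three_mul_add_four (y := 1 / 4) (by norm_num [abs_of_pos])).summable
  · obtain ⟨h0, h1⟩ := hx u hu
    have h3 : (1 - u ^ 2) ^ 3 ≤ 1 := pow_le_one₀ h0 h1
    have h3' : 0 ≤ (1 - u ^ 2) ^ 3 := pow_nonneg h0 3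
    have h := (hasSum_three_mul_add_four (y := (1 - u ^ 2) ^ 3 / 4)
      (by rw [abs_of_nonneg (by positivity)]; linarith)).mul_left ((1 - u ^ 2) ^ 4)
    have hN : 4 - (1 - u ^ 2) ^ 3 ≠ 0 := by linarith
    have hN' : 1 - (1 - u ^ 2) ^ 3 / 4 ≠ 0 := by linarith
    convert! h using 1
    · funext j
      rw [pow_add, pow_mul, div_pow, div_pow, one_pow]
      ring
    · rw [mul_div_assoc]
      congr 1
      rw [div_eq_div_iff (pow_ne_zero 2 hN) (pow_ne_zero 2 hN')]
      ring

/-- The bracket of the first series as a quotient of two rising factorials of length `3 j + 4`. -/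
lemma realRising_triple (j : ℕ) :
    realRising 1 (3 * j + 4) / realRising (3 / 2) (3 * j + 4) =
      128 / 315 * (realRising (5 / 3) j * realRising 2 j * realRising (7 / 3) j /
        (realRising (11 / 6) j * realRising (13 / 6) j * realRising (5 / 2) j)) := by
  induction j with
  | zero => norm_num [realRising, Finset.prod_range_succ]
  | succ j ih =>
    -- One step in `j` adds three factors to each long product; pulling a `3` out of each gives the
    -- six parameters, and the powers of `3` cancel. The constant `128 / 315` is `(1)_4 / (3/2)_4`.
    have e : 3 * (j + 1) + 4 = 3 * j + 4 + 1 + 1 + 1 := by ring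
    have h1 := realRising_pos (x := 3 / 2) (by norm_num) (3 * j + 4)
    have h2 := realRising_pos (x := 11 / 6) (by norm_num) j
    have h3 := realRising_pos (x := 13 / 6) (by norm_num) j
    have h4 := realRising_pos (x := 5 / 2) (by norm_num) j
    rw [div_eq_iff h1.ne'] at ih
    rw [e]
    rw [realRising_succ 1, realRising_succ 1, realRising_succ 1, realRising_succ (3 / 2),
      realRising_succ (3 / 2), realRising_succ (3 / 2), ih]
    simp only [realRising_succ _ j]
    push_cast
    field_simp
    ring

end integral

/-! ### The two-parameter family with rate `1/4`. -/

/-- The hypergeometric factor `4 ^ (-j) [s + c, s, 2 c; 1, 1 + c + s / 2, 1 / 2 + c + s / 2]_j`. -/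
noncomputable def quarterTerm (s c : ℝ) (j : ℕ) : ℝ :=
  realRising (s + c) j * realRising s j * realRising (2 * c) j /
    (realRising 1 j * realRising (1 + c + s / 2) j * realRising (1 / 2 + c + s / 2) j) *
      (1 / 4) ^ j

/-- The value of the series `∑ j, (3 j + 2 (s + c)) quarterTerm s c j`. -/
noncomputable def quarterValue (s c : ℝ) : ℝ :=
  2 * (s + c) * (Real.Gamma (c + 1) * Real.Gamma (s + 2 * c + 1) /
    (Real.Gamma (s + c + 1) * Real.Gamma (2 * c + 1)))

section quarter

variable {s c : ℝ}

lemma quarterTerm_zero : quarterTerm s c 0 = 1 := by simp [quarterTerm]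

lemma quarterTerm_succ (hs : 0 < s) (hc : 0 < c) (j : ℕ) :
    quarterTerm s c (j + 1) = quarterTerm s c j * ((s + c + j) * (s + j) * (2 * c + j) /
      ((1 + j) * (s + 2 * c + 1 + 2 * j) * (s + 2 * c + 2 + 2 * j))) := by
  have h1 := realRising_pos one_pos j
  have h2 := realRising_pos (x := 1 + c + s / 2) (by positivity) j
  have h3 := realRising_pos (x := 1 / 2 + c + s / 2) (by positivity) j
  simp only [quarterTerm, realRising_succ, pow_succ]
  generalize realRising (1 + c + s / 2) j = X at *
  generalize realRising (1 / 2 + c + s / 2) j = Y at *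
  generalize realRising (2 * c) j = Z at *
  generalize realRising (s + c) j = W at *
  field_simp
  ring

lemma quarterTerm_add_one (hs : 0 < s) (hc : 0 < c) (j : ℕ) :
    quarterTerm s (c + 1) j = quarterTerm s c j * ((s + c + j) * (2 * c + j) *
      (2 * c + j + 1) * (s + 2 * c + 1) * (s + 2 * c + 2) /
      ((s + c) * (2 * c) * (2 * c + 1) * (s + 2 * c + 1 + 2 * j) * (s + 2 * c + 2 + 2 * j))) := by
  have h1 := realRising_pos one_pos j
  have h2 := realRising_pos (x := 1 + c + s / 2) (by positivity) j
  have h3 := realRising_pos (x := 1 / 2 + c + s / 2) (by positivity) j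
  have e0 : s + (c + 1) = s + c + 1 := by ring
  have e1 : 2 * (c + 1) = 2 * c + 1 + 1 := by ring
  have e2 : 1 + (c + 1) + s / 2 = 1 + c + s / 2 + 1 := by ring
  have e3 : 1 / 2 + (c + 1) + s / 2 = 1 / 2 + c + s / 2 + 1 := by ring
  simp only [quarterTerm, e0, e1, e2, e3]
  rw [realRising_add_one (x := s + c) (by positivity),
    realRising_add_one (x := 2 * c + 1) (by positivity),
    realRising_add_one (x := 2 * c) (by positivity),
    realRising_add_one (x := 1 + c + s / 2) (by positivity),
    realRising_add_one (x := 1 / 2 + c + s / 2) (by positivity)]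
  generalize realRising (1 + c + s / 2) j = X at *
  generalize realRising (1 / 2 + c + s / 2) j = Y at *
  generalize realRising (2 * c) j = Z at *
  generalize realRising (s + c) j = W at *
  have f1 : 1 + c + s / 2 + j = (s + 2 * c + 2 + 2 * j) / 2 := by ring
  have f2 : 1 / 2 + c + s / 2 + j = (s + 2 * c + 1 + 2 * j) / 2 := by ring
  have f3 : 1 + c + s / 2 = (s + 2 * c + 2) / 2 := by ring
  have f4 : 1 / 2 + c + s / 2 = (s + 2 * c + 1) / 2 := by ring
  rw [f1, f2, f3, f4]
  field_simp
  ring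

lemma quarterTerm_pos (hs : 0 < s) (hc : 0 < c) (j : ℕ) : 0 < quarterTerm s c j := by
  have h1 := realRising_pos one_pos j
  have h2 := realRising_pos (x := 1 + c + s / 2) (by positivity) j
  have h3 := realRising_pos (x := 1 / 2 + c + s / 2) (by positivity) j
  have h4 := realRising_pos (add_pos hs hc) j
  have h5 := realRising_pos hs j
  have h6 := realRising_pos (x := 2 * c) (by positivity) j
  unfold quarterTerm
  positivity

/-- The bound is independent of `c`, as dominated convergence for `c → ∞` requires. -/
lemma quarterTerm_le (hs : 0 < s) (hs2 : s ≤ 2) (hc : 0 < c) (j : ℕ) :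
    quarterTerm s c j ≤ (j + 1) * (1 / 2) ^ j := by
  induction j with
  | zero => simp [quarterTerm_zero]
  | succ j ih =>
    have hj : (0 : ℝ) ≤ j := j.cast_nonneg
    -- The factor `(2 + j) / (1 + j)` telescopes to `j + 1`. Both it and the bound `1 / 2` on the
    -- second quotient below use `s ≤ 2`.
    have key : (s + c + j) * (s + j) * (2 * c + j) /
        ((1 + j) * (s + 2 * c + 1 + 2 * j) * (s + 2 * c + 2 + 2 * j)) ≤
        (2 + j) / (1 + j) * (1 / 2) := by
      calc _ = (s + j) / (1 + j) * ((s + c + j) / (s + 2 * c + 2 + 2 * j)) *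
            ((2 * c + j) / (s + 2 * c + 1 + 2 * j)) := by
            field_simp
        _ ≤ (2 + j) / (1 + j) * (1 / 2) * 1 := by
            have h1 : (s + c + j) / (s + 2 * c + 2 + 2 * j) ≤ 1 / 2 := by
              rw [div_le_div_iff₀ (by positivity) two_pos]; linarith
            have h2 : (2 * c + j) / (s + 2 * c + 1 + 2 * j) ≤ 1 := by
              rw [div_le_one (by positivity)]; linarith
            gcongr
        _ = _ := mul_one _
    rw [quarterTerm_succ hs hc]
    calc _ ≤ ((j + 1) * (1 / 2 : ℝ) ^ j) * ((2 + j) / (1 + j) * (1 / 2)) :=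
          mul_le_mul ih key (by positivity) (by positivity)
      _ = _ := by
          push_cast
          field_simp
          ring

lemma summable_pow_mul_half (k : ℕ) : Summable fun j : ℕ => (j : ℝ) ^ k * (1 / 2 : ℝ) ^ j :=
  summable_pow_mul_geometric_of_norm_lt_one k (by norm_num)

lemma summable_linear_mul_linear_mul_half (p q : ℝ) :
    Summable fun j : ℕ => (p * j + q) * ((j + 1) * (1 / 2 : ℝ) ^ j) := by
  refine (((summable_pow_mul_half 2).mul_left p).add (((summable_pow_mul_half 1).mul_left (p + q)).add
    ((summable_pow_mul_half 0).mul_left q))).congr fun j => ?_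
  ring

lemma summable_quarterTerm (hs : 0 < s) (hs2 : s ≤ 2) (hc : 0 < c) :
    Summable fun j : ℕ => (3 * j + 2 * (s + c)) * quarterTerm s c j :=
  (summable_linear_mul_linear_mul_half 3 (2 * (s + c))).of_nonneg_of_le
    (fun j => mul_nonneg (by positivity) (quarterTerm_pos hs hc j).le)
    fun j => mul_le_mul_of_nonneg_left (quarterTerm_le hs hs2 hc j) (by positivity)

/-- The telescoping partner of `quarterTerm`. -/
noncomputable def quarterCert (s c : ℝ) (j : ℕ) : ℝ :=
  -(quarterTerm s c j * (j * (j + s) / c))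

/-- The WZ-type identity: dividing by `quarterTerm s c j` turns it into an identity of rational
functions in `j`, `s`, `c`. -/
lemma quarterTerm_telescope (hs : 0 < s) (hc : 0 < c) (j : ℕ) :
    2 * (s + c) * (2 * c + 1) * ((3 * j + 2 * (s + (c + 1))) * quarterTerm s (c + 1) j) =
      (s + 2 * c + 1) * (s + 2 * c + 2) * ((3 * j + 2 * (s + c)) * quarterTerm s c j +
        (quarterCert s c (j + 1) - quarterCert s c j)) := by
  rw [quarterCert, quarterCert, quarterTerm_add_one hs hc, quarterTerm_succ hs hc]
  push_cast
  field_simp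
  ring

lemma tendsto_quarterCert (hs : 0 < s) (hs2 : s ≤ 2) (hc : 0 < c) :
    Tendsto (quarterCert s c) atTop (𝓝 0) := by
  have h : ∀ k : ℕ, Tendsto (fun j : ℕ => (j : ℝ) ^ k * (1 / 2 : ℝ) ^ j) atTop (𝓝 0) := fun k =>
    (summable_pow_mul_half k).tendsto_atTop_zero
  have hb : Tendsto (fun j : ℕ => ((j + 1) * (1 / 2 : ℝ) ^ j) * (j * (j + s) / c)) atTop
      (𝓝 0) := by
    have := (((h 3).add ((h 2).const_mul (1 + s))).add ((h 1).const_mul s)).mul_const c⁻¹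
    rw [mul_zero, mul_zero, add_zero, add_zero, zero_mul] at this
    refine this.congr fun j => ?_
    ring
  unfold quarterCert
  rw [← neg_zero]
  refine Tendsto.neg (squeeze_zero (fun j => ?_) (fun j => ?_) hb)
  · have := quarterTerm_pos hs hc j
    positivity
  · exact mul_le_mul_of_nonneg_right (quarterTerm_le hs hs2 hc j) (by positivity)

/-- Summing the telescoping identity leaves no boundary terms: the certificate has a factor `j`, so
vanishes at `0`, and it tends to `0` at infinity. -/
lemma tsum_quarterTerm_add_one (hs : 0 < s) (hs2 : s ≤ 2) (hc : 0 < c) :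
    2 * (s + c) * (2 * c + 1) *
        ∑' j : ℕ, (3 * (j : ℝ) + 2 * (s + (c + 1))) * quarterTerm s (c + 1) j =
      (s + 2 * c + 1) * (s + 2 * c + 2) *
        ∑' j : ℕ, (3 * (j : ℝ) + 2 * (s + c)) * quarterTerm s c j := by
  have h1 := summable_quarterTerm hs hs2 hc
  have h2 := summable_quarterTerm hs hs2 (c := c + 1) (by positivity)
  have hd : (s + 2 * c + 1) * (s + 2 * c + 2) ≠ 0 := by positivity
  have h3 : Summable fun j => quarterCert s c (j + 1) - quarterCert s c j := by
    refine (((h2.mul_left (2 * (s + c) * (2 * c + 1))).mul_left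
      ((s + 2 * c + 1) * (s + 2 * c + 2))⁻¹).sub h1).congr fun j => ?_
    rw [quarterTerm_telescope hs hc, inv_mul_cancel_left₀ hd]
    ring
  have h4 : ∑' j, (quarterCert s c (j + 1) - quarterCert s c j) = 0 := by
    refine tendsto_nhds_unique h3.hasSum.tendsto_sum_nat ?_
    have h0 : quarterCert s c 0 = 0 := by simp [quarterCert]
    simp_rw [Finset.sum_range_sub, h0, sub_zero]
    exact tendsto_quarterCert hs hs2 hc
  rw [← tsum_mul_left, tsum_congr (quarterTerm_telescope hs hc), tsum_mul_left,
    h1.tsum_add h3, h4, add_zero]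

lemma quarterValue_pos (hs : 0 < s) (hc : 0 < c) : 0 < quarterValue s c := by
  have g1 := Real.Gamma_pos_of_pos (s := s + c + 1) (by positivity)
  have g2 := Real.Gamma_pos_of_pos (s := 2 * c + 1) (by positivity)
  have g3 := Real.Gamma_pos_of_pos (s := c + 1) (by positivity)
  have g4 := Real.Gamma_pos_of_pos (s := s + 2 * c + 1) (by positivity)
  unfold quarterValue
  positivity

lemma quarterValue_add_one (hs : 0 < s) (hc : 0 < c) :
    2 * (s + c) * (2 * c + 1) * quarterValue s (c + 1) =
      (s + 2 * c + 1) * (s + 2 * c + 2) * quarterValue s c := by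
  have e1 : s + (c + 1) + 1 = s + c + 1 + 1 := by ring
  have e2 : s + 2 * (c + 1) + 1 = s + 2 * c + 1 + 1 + 1 := by ring
  have e3 : 2 * (c + 1) + 1 = 2 * c + 1 + 1 + 1 := by ring
  have g1 := Real.Gamma_pos_of_pos (s := s + c + 1) (by positivity)
  have g2 := Real.Gamma_pos_of_pos (s := 2 * c + 1) (by positivity)
  rw [quarterValue, quarterValue, e1, e2, e3,
    Real.Gamma_add_one (s := c + 1) (by positivity),
    Real.Gamma_add_one (s := s + 2 * c + 1 + 1) (by positivity),
    Real.Gamma_add_one (s := s + 2 * c + 1) (by positivity),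
    Real.Gamma_add_one (s := s + c + 1) (by positivity),
    Real.Gamma_add_one (s := 2 * c + 1 + 1) (by positivity),
    Real.Gamma_add_one (s := 2 * c + 1) (by positivity)]
  generalize Real.Gamma (s + c + 1) = X at *
  generalize Real.Gamma (2 * c + 1) = Y at *
  field_simp
  ring

lemma tendsto_quarterTerm (hs : 0 < s) (hc : 0 < c) (j : ℕ) :
    Tendsto (fun n : ℕ => quarterTerm s (c + n) j) atTop
      (𝓝 (realRising s j / realRising 1 j * (1 / 2) ^ j)) := by
  induction j with
  | zero => simp [quarterTerm_zero]
  | succ j ih =>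
    have h := ih.mul ((((tendsto_natCast_add_div_natCast_add (s + c + j) (s / 2 + c + 1 + j)).mul
      (tendsto_natCast_add_div_natCast_add (c + j / 2) (s / 2 + c + 1 / 2 + j)))).const_mul
      ((s + j) / (1 + j) * (1 / 2)))
    convert! h using 1
    · funext n
      rw [quarterTerm_succ hs (by positivity)]
      congr 1
      have e1 : s + 2 * (c + n) + 1 + 2 * (j : ℝ) = 2 * (n + (s / 2 + c + 1 / 2 + j)) := by ring
      have e2 : s + 2 * (c + n) + 2 + 2 * (j : ℝ) = 2 * (n + (s / 2 + c + 1 + j)) := by ring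
      rw [e1, e2, div_mul_div_comm, div_mul_div_comm, div_mul_div_comm, div_eq_div_iff
        (by positivity) (by positivity)]
      ring
    · rw [realRising_succ, realRising_succ, pow_succ]
      have := realRising_pos one_pos j
      congr 1
      field_simp

lemma tendsto_tsum_quarterTerm (hs : 0 < s) (hs2 : s ≤ 2) (hc : 0 < c) :
    Tendsto (fun n : ℕ => (∑' j : ℕ, (3 * (j : ℝ) + 2 * (s + (c + n))) * quarterTerm s (c + n) j) /
      (2 * (s + (c + n)))) atTop (𝓝 (2 ^ s)) := by
  rw [← (hasSum_realRising_half s).tsum_eq]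
  simp_rw [← tsum_div_const]
  -- The normalised linear factor is `1 + 3 j / (2 (s + c + n))`, largest at `n = 0`; this gives the
  -- majorant.
  refine tendsto_tsum_of_dominated_convergence
    (summable_linear_mul_linear_mul_half (3 / (2 * (s + c))) 1) (fun j => ?_)
    (Eventually.of_forall fun n j => ?_)
  · have h1 : Tendsto (fun n : ℕ => 3 * (j : ℝ) / 2 / ((n : ℝ) + (s + c)) + 1) atTop (𝓝 1) := by
      simpa using ((tendsto_atTop_add_const_right _ (s + c)
        tendsto_natCast_atTop_atTop).const_div_atTop (3 * (j : ℝ) / 2)).add_const 1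
    have h2 := h1.mul (tendsto_quarterTerm hs hc j)
    rw [one_mul] at h2
    refine h2.congr fun n => ?_
    field_simp
    ring
  · have h1 := quarterTerm_pos hs (c := c + n) (by positivity) j
    have h2 := quarterTerm_le hs hs2 (c := c + n) (by positivity) j
    rw [Real.norm_of_nonneg (by positivity), mul_div_right_comm]
    refine mul_le_mul ?_ h2 h1.le (by positivity)
    rw [add_div, div_self (by positivity), mul_div_right_comm]
    gcongr
    linarith [(n.cast_nonneg : (0 : ℝ) ≤ n)]

lemma tendsto_quarterValue (hs : 0 < s) (hc : 0 < c) :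
    Tendsto (fun n : ℕ => quarterValue s (c + n) / (2 * (s + (c + n)))) atTop (𝓝 (2 ^ s)) := by
  -- Shifting `c` by `n` shifts the arguments containing `2 c` by `2 n`, so those asymptotics are
  -- taken along even indices. The factorials cancel and the powers leave `2 ^ s`.
  have ht : Tendsto (fun n : ℕ => 2 * n) atTop atTop :=
    tendsto_id.const_mul_atTop' two_pos
  have h1 := tendsto_Gamma_div_rpow_mul_factorial hc
  have h2 := (tendsto_Gamma_div_rpow_mul_factorial (x := s + 2 * c) (by positivity)).comp ht
  have h3 := tendsto_Gamma_div_rpow_mul_factorial (add_pos hs hc)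
  have h4 := (tendsto_Gamma_div_rpow_mul_factorial (x := 2 * c) (by positivity)).comp ht
  have h := ((h1.mul h2).div (h3.mul h4) (by norm_num)).const_mul ((2 : ℝ) ^ s)
  norm_num at h
  refine h.congr' ?_
  filter_upwards [eventually_gt_atTop 0] with n hn
  have hn0 : (0 : ℝ) < n := by exact_mod_cast hn
  have g3 := Real.Gamma_pos_of_pos (s := s + c + n + 1) (by positivity)
  have g4 := Real.Gamma_pos_of_pos (s := 2 * c + 2 * n + 1) (by positivity)
  have e2 : s + 2 * (c + n) + 1 = s + 2 * c + 2 * n + 1 := by ring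
  have e3 : 2 * (c + n) + 1 = 2 * c + 2 * n + 1 := by ring
  have e4 : s + (c + n) + 1 = s + c + n + 1 := by ring
  have hp : (2 : ℝ) ^ s * ((n : ℝ) ^ (s + c) * (2 * n : ℝ) ^ (2 * c)) =
      (n : ℝ) ^ c * (2 * n : ℝ) ^ (s + 2 * c) := by
    rw [Real.mul_rpow two_pos.le hn0.le, Real.mul_rpow two_pos.le hn0.le, Real.rpow_add two_pos,
      Real.rpow_add hn0, Real.rpow_add hn0]
    ring
  have p1 : (0 : ℝ) < (n : ℝ) ^ (s + c) := Real.rpow_pos_of_pos hn0 _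
  have p2 : (0 : ℝ) < (2 * n : ℝ) ^ (2 * c) := Real.rpow_pos_of_pos (by positivity) _
  have p3 : (0 : ℝ) < (n : ℝ) ^ c := Real.rpow_pos_of_pos hn0 _
  have p4 : (0 : ℝ) < (2 * n : ℝ) ^ (s + 2 * c) := Real.rpow_pos_of_pos (by positivity) _
  have p5 : (0 : ℝ) < n.factorial := by positivity
  have p6 : (0 : ℝ) < (2 * n).factorial := by positivity
  rw [quarterValue, e2, e3, e4,
    mul_div_cancel_left₀ _ (by positivity : 2 * (s + (c + (n : ℝ))) ≠ 0)]
  generalize Real.Gamma (s + c + n + 1) = G3 at *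
  generalize Real.Gamma (2 * c + 2 * n + 1) = G4 at *
  generalize Real.Gamma (c + n + 1) = G1 at *
  generalize Real.Gamma (s + 2 * c + 2 * n + 1) = G2 at *
  generalize (n : ℝ) ^ (s + c) = A1 at *
  generalize (2 * n : ℝ) ^ (2 * c) = A2 at *
  generalize (n : ℝ) ^ c = A3 at *
  generalize (2 * n : ℝ) ^ (s + 2 * c) = A4 at *
  generalize (2 : ℝ) ^ s = A5 at *
  field_simp
  linear_combination G1 * G2 * hp

theorem hasSum_quarterTerm (hs : 0 < s) (hs2 : s ≤ 2) (hc : 0 < c) :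
    HasSum (fun j : ℕ => (3 * (j : ℝ) + 2 * (s + c)) * quarterTerm s c j) (quarterValue s c) := by
  have hsum := (summable_quarterTerm hs hs2 hc).hasSum
  set S : ℝ → ℝ := fun c => ∑' j : ℕ, (3 * (j : ℝ) + 2 * (s + c)) * quarterTerm s c j with hS
  have hconst : ∀ n : ℕ, S (c + n) / quarterValue s (c + n) = S c / quarterValue s c := by
    intro n
    induction n with
    | zero => simp
    | succ n ih =>
      have hb : 0 < c + n := by positivity
      have h1 : 2 * (s + (c + n)) * (2 * (c + n) + 1) * S (c + n + 1) =
        (s + 2 * (c + n) + 1) * (s + 2 * (c + n) + 2) * S (c + n) :=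
        tsum_quarterTerm_add_one hs hs2 hb
      have h2 := quarterValue_add_one hs hb
      have h3 := quarterValue_pos hs hb
      have h4 := quarterValue_pos hs (c := c + n + 1) (by positivity)
      rw [← ih, Nat.cast_succ, ← add_assoc, div_eq_div_iff h4.ne' h3.ne']
      have h5 : 2 * (s + (c + n)) * (2 * (c + n) + 1) ≠ 0 := by positivity
      refine mul_left_cancel₀ h5 ?_
      linear_combination quarterValue s (c + n) * h1 - S (c + n) * h2
  have hlim := (tendsto_tsum_quarterTerm hs hs2 hc).div (tendsto_quarterValue hs hc)
    (by positivity)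
  rw [div_self (by positivity)] at hlim
  have h1 : S c / quarterValue s c = 1 := by
    refine tendsto_nhds_unique (tendsto_const_nhds.congr fun n => ?_) hlim
    rw [← hconst n, Pi.div_apply, div_div_div_cancel_right₀ (by positivity)]
  rw [div_eq_one_iff_eq (quarterValue_pos hs hc).ne'] at h1
  rw [← h1]
  exact hsum

end quarter

/-! ### The side conditions of Ramanujan type. -/

lemma ne_intCast_of_den_ne_one {x : ℚ} (hx : x.den ≠ 1) (m : ℤ) : x ≠ m := by
  rintro rfl
  exact hx (Rat.den_intCast m)

lemma tendsto_realRising_ratio {x y : ℝ} (hx : 0 < x) (hy : 0 < y) :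
    Tendsto (fun j : ℕ => realRising x (j + 1) / realRising x j /
      (realRising y (j + 1) / realRising y j)) atTop (𝓝 1) := by
  refine (tendsto_natCast_add_div_natCast_add x y).congr fun j => ?_
  have h1 := realRising_pos hx j
  have h2 := realRising_pos hy j
  rw [realRising_succ, realRising_succ, mul_div_cancel_left₀ _ h1.ne',
    mul_div_cancel_left₀ _ h2.ne', add_comm x, add_comm y]

lemma tendsto_ramanujanTerm_ratio {z : ℚ} (hz : 0 < z) {a b : Fin 3 → ℚ} (ha : ∀ i, 0 < a i)
    (hb : ∀ i, 0 < b i) {c₁ c₂ : ℚ} (h₁ : 0 < c₁) (h₂ : 0 < c₂) :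
    Tendsto (fun j => ramanujanTerm z a b c₁ c₂ (j + 1) / ramanujanTerm z a b c₁ c₂ j)
      atTop (𝓝 (z : ℝ)) := by
  have hz' : (0 : ℝ) < z := by exact_mod_cast hz
  have ha' : ∀ i, (0 : ℝ) < a i := fun i => by exact_mod_cast ha i
  have hb' : ∀ i, (0 : ℝ) < b i := fun i => by exact_mod_cast hb i
  have h₁' : (0 : ℝ) < c₁ := by exact_mod_cast h₁
  have h₂' : (0 : ℝ) < c₂ := by exact_mod_cast h₂
  have h := ((((tendsto_realRising_ratio (ha' 0) (hb' 0)).mul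
    (tendsto_realRising_ratio (ha' 1) (hb' 1))).mul
    (tendsto_realRising_ratio (ha' 2) (hb' 2))).mul
    (tendsto_natCast_add_div_natCast_add (1 + c₂ / c₁ : ℝ) (c₂ / c₁ : ℝ))).const_mul (z : ℝ)
  rw [mul_one, mul_one, mul_one, mul_one] at h
  refine h.congr fun j => ?_
  have p : ∀ (i : Fin 3) (k : ℕ), 0 < realRising (a i) k := fun i k => realRising_pos (ha' i) k
  have q : ∀ (i : Fin 3) (k : ℕ), 0 < realRising (b i) k := fun i k => realRising_pos (hb' i) k
  have p0 := p 0 j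
  have p1 := p 1 j
  have p2 := p 2 j
  have q0 := q 0 j
  have q1 := q 1 j
  have q2 := q 2 j
  have r0 := q 0 (j + 1)
  have r1 := q 1 (j + 1)
  have r2 := q 2 (j + 1)
  simp only [ramanujanTerm, risingFactorial_eq_realRising, Fin.prod_univ_three, pow_succ,
    Nat.cast_succ]
  field_simp
  ring

lemma isRamanujanTypeFormula_of_pos {z : ℚ} (hz : 0 < z) {a b : Fin 3 → ℚ} (ha : ∀ i, 0 < a i)
    (hb : ∀ i, 0 < b i) (hab : ∀ i k, (a i - b k).den ≠ 1) {c₁ c₂ : ℚ} (h₁ : 0 < c₁)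
    (h₂ : 0 < c₂) {S : ℝ} (hS : HasSum (ramanujanTerm z a b c₁ c₂) S) :
    IsRamanujanTypeFormula z a b c₁ c₂ S where
  lower_ne k m h := by
    have h3 : (0 : ℚ) ≤ m := m.cast_nonneg
    have h4 := hb k
    linarith
  irreducible i k m := ne_intCast_of_den_ne_one (hab i k) m
  rate := tendsto_ramanujanTerm_ratio hz ha hb h₁ h₂
  hasSum := hS

/-! ### Closed forms of the Gamma quotients. -/

section values

open Real

lemma Gamma_mul_Gamma_one_sub_eq (x : ℝ) {t : ℝ} (h : sin (π * x) = t) :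
    Gamma x * Gamma (1 - x) = π / t := by
  rw [Real.Gamma_mul_Gamma_one_sub, h]

lemma Gamma_one_div_four_mul : Gamma (1 / 4) * Gamma (3 / 4) = π * √2 := by
  have h := Gamma_mul_Gamma_one_sub_eq (1 / 4) (t := √2 / 2)
    (by rw [← sin_pi_div_four]; ring_nf)
  norm_num at h
  rw [h]
  have : √2 ^ 2 = 2 := sq_sqrt (by norm_num)
  field_simp
  linarith

lemma Gamma_one_div_six_mul : Gamma (1 / 6) * Gamma (5 / 6) = 2 * π := by
  have h := Gamma_mul_Gamma_one_sub_eq (1 / 6) (t := 1 / 2)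
    (by rw [← sin_pi_div_six]; ring_nf)
  norm_num at h
  rw [h]
  ring

lemma Gamma_one_div_three_mul : Gamma (1 / 3) * Gamma (2 / 3) = 2 * π / √3 := by
  have h := Gamma_mul_Gamma_one_sub_eq (1 / 3) (t := √3 / 2)
    (by rw [← sin_pi_div_three]; ring_nf)
  norm_num at h
  rw [h]
  field_simp

lemma Gamma_one_div_six_mul_eq :
    Gamma (1 / 6) * Gamma (5 / 6) = √3 * (Gamma (1 / 3) * Gamma (2 / 3)) := by
  rw [Gamma_one_div_six_mul, Gamma_one_div_three_mul]
  field_simp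

/-- Legendre duplication at `1 / 6`; writing `2 ^ (2/3)` as `2 / 2 ^ (1/3)` leaves only the cube
root of the final formula. -/
lemma Gamma_one_div_six_mul_Gamma_two_div_three :
    Gamma (1 / 6) * Gamma (2 / 3) = Gamma (1 / 3) * (2 / (2 : ℝ) ^ ((1 : ℝ) / 3)) * √π := by
  have h := Gamma_mul_Gamma_add_half (1 / 6)
  have e : (2 : ℝ) ^ (1 - 2 * (1 / 6) : ℝ) = 2 / (2 : ℝ) ^ ((1 : ℝ) / 3) := by
    rw [rpow_sub two_pos, rpow_one]
    norm_num
  rw [e] at h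
  norm_num at h ⊢
  exact h

lemma quarterValue_five_fourths : quarterValue (5 / 4) (1 / 4) = 21 * √2 / 8 := by
  have g : 0 < Gamma (3 / 4) := Gamma_pos_of_pos (by norm_num)
  have h := eq_div_of_mul_eq g.ne' Gamma_one_div_four_mul
  have e2 : (5 / 4 + 2 * (1 / 4) + 1 : ℝ) = 3 / 4 + 1 + 1 := by norm_num
  have e3 : (5 / 4 + 1 / 4 + 1 : ℝ) = 1 / 2 + 1 + 1 := by norm_num
  have e4 : (2 * (1 / 4) + 1 : ℝ) = 1 / 2 + 1 := by norm_num
  have hp : √π ^ 2 = π := sq_sqrt pi_pos.le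
  have hp0 := sqrt_pos.2 pi_pos
  rw [quarterValue, e2, e3, e4]
  repeat rw [Gamma_add_one (by norm_num)]
  rw [Gamma_one_half_eq, h]
  field_simp
  rw [hp]
  ring

lemma quarterValue_three_halves_seven_sixths :
    quarterValue (3 / 2) (7 / 6) = 4301 * √3 / 768 := by
  have g1 : 0 < Gamma (1 / 3) := Gamma_pos_of_pos (by norm_num)
  have g2 : 0 < Gamma (2 / 3) := Gamma_pos_of_pos (by norm_num)
  have g5 : 0 < Gamma (5 / 6) := Gamma_pos_of_pos (by norm_num)
  have h := eq_div_of_mul_eq g5.ne' Gamma_one_div_six_mul_eq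
  have e1 : (7 / 6 + 1 : ℝ) = 1 / 6 + 1 + 1 := by norm_num
  have e2 : (3 / 2 + 2 * (7 / 6) + 1 : ℝ) = 5 / 6 + 1 + 1 + 1 + 1 := by norm_num
  have e3 : (3 / 2 + 7 / 6 + 1 : ℝ) = 2 / 3 + 1 + 1 + 1 := by norm_num
  have e4 : (2 * (7 / 6) + 1 : ℝ) = 1 / 3 + 1 + 1 + 1 := by norm_num
  rw [quarterValue, e2, e3, e4, e1]
  repeat rw [Gamma_add_one (by norm_num)]
  rw [h]
  field_simp
  norm_num

lemma quarterValue_one_half_seven_sixths :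
    quarterValue (1 / 2) (7 / 6) = 935 * √3 / 384 := by
  have g1 : 0 < Gamma (1 / 3) := Gamma_pos_of_pos (by norm_num)
  have g2 : 0 < Gamma (2 / 3) := Gamma_pos_of_pos (by norm_num)
  have g5 : 0 < Gamma (5 / 6) := Gamma_pos_of_pos (by norm_num)
  have h := eq_div_of_mul_eq g5.ne' Gamma_one_div_six_mul_eq
  have e1 : (7 / 6 + 1 : ℝ) = 1 / 6 + 1 + 1 := by norm_num
  have e2 : (1 / 2 + 2 * (7 / 6) + 1 : ℝ) = 5 / 6 + 1 + 1 + 1 := by norm_num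
  have e3 : (1 / 2 + 7 / 6 + 1 : ℝ) = 2 / 3 + 1 + 1 := by norm_num
  have e4 : (2 * (7 / 6) + 1 : ℝ) = 1 / 3 + 1 + 1 + 1 := by norm_num
  rw [quarterValue, e2, e3, e4, e1]
  repeat rw [Gamma_add_one (by norm_num)]
  rw [h]
  field_simp
  norm_num

lemma quarterValue_three_halves_five_sixths :
    quarterValue (3 / 2) (5 / 6) = 1729 * √3 / 384 := by
  have g1 : 0 < Gamma (1 / 3) := Gamma_pos_of_pos (by norm_num)
  have g2 : 0 < Gamma (2 / 3) := Gamma_pos_of_pos (by norm_num)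
  have g5 : 0 < Gamma (5 / 6) := Gamma_pos_of_pos (by norm_num)
  have h := eq_div_of_mul_eq g5.ne' Gamma_one_div_six_mul_eq
  have e2 : (3 / 2 + 2 * (5 / 6) + 1 : ℝ) = 1 / 6 + 1 + 1 + 1 + 1 := by norm_num
  have e3 : (3 / 2 + 5 / 6 + 1 : ℝ) = 1 / 3 + 1 + 1 + 1 := by norm_num
  have e4 : (2 * (5 / 6) + 1 : ℝ) = 2 / 3 + 1 + 1 := by norm_num
  rw [quarterValue, e2, e3, e4]
  repeat rw [Gamma_add_one (by norm_num)]
  rw [h]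
  field_simp
  norm_num

lemma quarterValue_five_sixths :
    quarterValue (5 / 6) (1 / 3) = 9 * (2 : ℝ) ^ ((1 : ℝ) / 3) / 4 := by
  have g1 : 0 < Gamma (1 / 3) := Gamma_pos_of_pos (by norm_num)
  have g2 : 0 < Gamma (2 / 3) := Gamma_pos_of_pos (by norm_num)
  have h := eq_div_of_mul_eq g2.ne' Gamma_one_div_six_mul_Gamma_two_div_three
  have e2 : (5 / 6 + 2 * (1 / 3) + 1 : ℝ) = 1 / 2 + 1 + 1 := by norm_num
  have e3 : (5 / 6 + 1 / 3 + 1 : ℝ) = 1 / 6 + 1 + 1 := by norm_num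
  have e4 : (2 * (1 / 3) + 1 : ℝ) = 2 / 3 + 1 := by norm_num
  have hp0 := sqrt_pos.2 pi_pos
  have ht : (0 : ℝ) < (2 : ℝ) ^ ((1 : ℝ) / 3) := rpow_pos_of_pos two_pos _
  rw [quarterValue, e2, e3, e4]
  repeat rw [Gamma_add_one (by norm_num)]
  rw [Gamma_one_half_eq, h]
  generalize (2 : ℝ) ^ ((1 : ℝ) / 3) = t at *
  field_simp
  norm_num

end values

/-! ### Specialisation to the six formulas. -/

lemma hasSum_ramanujanTerm_of_quarter {s c : ℝ} (hs : 0 < s) (hs2 : s ≤ 2) (hc : 0 < c)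
    {a b : Fin 3 → ℚ}
    (ha : ∀ j, ∏ i, risingFactorial (a i) j =
      realRising (s + c) j * realRising s j * realRising (2 * c) j)
    (hb : ∀ j, ∏ i, risingFactorial (b i) j =
      realRising 1 j * realRising (1 + c + s / 2) j * realRising (1 / 2 + c + s / 2) j)
    {c₁ c₂ : ℚ} (k : ℝ) (h₁ : (c₁ : ℝ) = k * 3) (h₂ : (c₂ : ℝ) = k * (2 * (s + c))) {S : ℝ}
    (hS : k * quarterValue s c = S) :
    HasSum (ramanujanTerm (1 / 4) a b c₁ c₂) S := by
  rw [← hS]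
  convert! (hasSum_quarterTerm hs hs2 hc).mul_left k using 1
  funext j
  rw [ramanujanTerm, ha, hb, h₁, h₂, quarterTerm]
  push_cast
  ring

lemma hasSum_ramanujanTerm_pi :
    HasSum (ramanujanTerm (1 / 4) ![5 / 3, 2, 7 / 3] ![11 / 6, 13 / 6, 5 / 2] 3 4)
      (105 * Real.pi / (32 * Real.sqrt 3)) := by
  have h := hasSum_mul_integral_one_sub_sq_pow.mul_left (315 / 128)
  convert! h using 1
  · funext j
    rw [integral_one_sub_sq_pow, realRising_triple]
    simp [ramanujanTerm, risingFactorial_eq_realRising, Fin.prod_univ_three]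
    ring
  · field_simp
    norm_num

theorem mainTheorem7 :
    IsRamanujanTypeFormula (1 / 4) ![5 / 3, 2, 7 / 3] ![11 / 6, 13 / 6, 5 / 2] 3 4
      (105 * Real.pi / (32 * Real.sqrt 3)) ∧
    IsRamanujanTypeFormula (1 / 4) ![1 / 2, 5 / 4, 3 / 2] ![1, 11 / 8, 15 / 8] 1 1
      (7 * Real.sqrt 2 / 8) ∧
    IsRamanujanTypeFormula (1 / 4) ![3 / 2, 7 / 3, 8 / 3] ![1, 29 / 12, 35 / 12] 9 16
      (4301 * Real.sqrt 3 / 256) ∧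
    IsRamanujanTypeFormula (1 / 4) ![1 / 2, 5 / 3, 7 / 3] ![1, 23 / 12, 29 / 12] 9 10
      (935 * Real.sqrt 3 / 128) ∧
    IsRamanujanTypeFormula (1 / 4) ![3 / 2, 5 / 3, 7 / 3] ![1, 25 / 12, 31 / 12] 9 14
      (1729 * Real.sqrt 3 / 128) ∧
    IsRamanujanTypeFormula (1 / 4) ![2 / 3, 5 / 6, 7 / 6] ![1, 5 / 4, 7 / 4] 9 7
      (27 * (2 : ℝ) ^ ((1 : ℝ) / 3) / 4) := by
  refine ⟨?_, ?_, ?_, ?_, ?_, ?_⟩ <;>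
    refine isRamanujanTypeFormula_of_pos (by norm_num) (by decide +kernel) (by decide +kernel)
      (by decide +kernel) (by norm_num) (by norm_num) ?_
  · exact hasSum_ramanujanTerm_pi
  · refine hasSum_ramanujanTerm_of_quarter (s := 5 / 4) (c := 1 / 4) (by norm_num) (by norm_num)
      (by norm_num) (fun j => ?_) (fun j => ?_) (1 / 3) (by norm_num) (by norm_num)
      (by rw [quarterValue_five_fourths]; ring) <;>
    · simp only [risingFactorial_eq_realRising, Fin.prod_univ_three, Matrix.cons_val]
      push_cast
      ring_nf
  · refine hasSum_ramanujanTerm_of_quarter (s := 3 / 2) (c := 7 / 6) (by norm_num) (by norm_num)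
      (by norm_num) (fun j => ?_) (fun j => ?_) (3) (by norm_num) (by norm_num)
      (by rw [quarterValue_three_halves_seven_sixths]; ring) <;>
    · simp only [risingFactorial_eq_realRising, Fin.prod_univ_three, Matrix.cons_val]
      push_cast
      ring_nf
  · refine hasSum_ramanujanTerm_of_quarter (s := 1 / 2) (c := 7 / 6) (by norm_num) (by norm_num)
      (by norm_num) (fun j => ?_) (fun j => ?_) (3) (by norm_num) (by norm_num)
      (by rw [quarterValue_one_half_seven_sixths]; ring) <;>
    · simp only [risingFactorial_eq_realRising, Fin.prod_univ_three, Matrix.cons_val]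
      push_cast
      ring_nf
  · refine hasSum_ramanujanTerm_of_quarter (s := 3 / 2) (c := 5 / 6) (by norm_num) (by norm_num)
      (by norm_num) (fun j => ?_) (fun j => ?_) (3) (by norm_num) (by norm_num)
      (by rw [quarterValue_three_halves_five_sixths]; ring) <;>
    · simp only [risingFactorial_eq_realRising, Fin.prod_univ_three, Matrix.cons_val]
      push_cast
      ring_nf
  · refine hasSum_ramanujanTerm_of_quarter (s := 5 / 6) (c := 1 / 3) (by norm_num) (by norm_num)
      (by norm_num) (fun j => ?_) (fun j => ?_) (3) (by norm_num) (by norm_num)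
      (by rw [quarterValue_five_sixths]; ring) <;>
    · simp only [risingFactorial_eq_realRising, Fin.prod_univ_three, Matrix.cons_val]
      push_cast
      ring_nf
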